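/- Let $m$ be an odd positive integer and let $\mathbb R_{0,m}$ be the real Clifford algebra generated by the orthonormal basis $e_1,\dots,e_m$ of $\mathbb R^m$ with $e_j^2=-1$ and $e_je_l+e_le_j=0$ for $j\ne l$; vectors $\underline x=\sum_{j=1}^m x_je_j$ are regarded as elements of $\mathbb R_{0,m}$. Put $\partial_{\underline x}=\sum_{j=1}^m e_j\partial_{x_j}$ and $\partial_x=\partial_{x_0}+\partial_{\underline x}$, acting from the left on $\mathbb R_{0,m}$-valued functions of $\underline x\in\mathbb R^m$, respectively of $x=(x_0,\underline x)\in\mathbb R^{m+1}$. Let $\Delta_x=\sum_{j=0}^m\partial_{x_j}^2$. A $C^1$ function $F:\mathbb R^{m+1}\to\mathbb R_{0,m}$ with $\partial_xF=0$ everywhere is called entire monogenic. Let $P_k:\mathbb R^m\to\mathbb R_{0,m}$ be a homogeneous monogenic polynomial of degree $k\ge 0$, i.e. a polynomial with coefficients in $\mathbb R_{0,m}$ such that $\partial_{\underline x}P_k=0$ and $P_k(t\underline x)=t^kP_k(\underline x)$ for all $t\in\mathbb R$. For $f=u+iv$ put, with $r=|\underline x|$ and $\underline\omega=\underline x/r$,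 $$\mathsf{Ft}[f(z),P_k(\underline x)](x)=\Delta_x^{k+\frac{m-1}{2}}\bigl[\bigl(u(x_0,r)+\underline\omega\,v(x_0,r)\bigr)P_k(\underline x)\bigr],$$ where $u+\underline\omega v$ is read as $u$ at points with $r=0$ (for the functions $f=H$ below, $v(x_0,0)=0$). For a polynomial $g:\mathbb R^m\to\mathbb R_{0,m}$ put $$\mathsf{CK}[g](x)=\sum_{n=0}^\infty\frac{(-x_0)^n}{n!}\,\partial_{\underline x}^n g(\underline x).$$ Let $H(z)=\sum_{n=0}^\infty c_nz^n$ be entire with real coefficients $c_n$. Then $\mathsf{Ft}[H(z),P_k(\underline x)]$ is an entire monogenic function on $\mathbb R^{m+1}$. The series defining $\mathsf{CK}[\underline x^{\,j}P_k(\underline x)](x)$ converges for all $j\ge0$ and all $x\in\mathbb R^{m+1}$, and there are real numbers $C_n$, $n\ge 2k+m-1$, such that for every $x\in\mathbb R^{m+1}$ $$\mathsf{Ft}[H(z),P_k(\underline x)](x)=\sum_{n=2k+m-1}^\infty C_n\,\mathsf{CK}[\underline x^{\,n-(2k+m-1)}P_k(\underline x)](x),$$ the series being convergent. -/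

import Mathlib

noncomputable section

namespace Fueter

/-! ### The Clifford algebra with its standard basis and norm -/

/-- `ℝ^m` with its Euclidean structure. -/
abbrev Vec (m : ℕ) : Type := EuclideanSpace ℝ (Fin m)

/-- The quadratic form `x ↦ -|x|²` on `ℝ^m`. -/
def negSq (m : ℕ) : QuadraticForm ℝ (Vec m) :=
  -(LinearMap.BilinMap.toQuadraticMap (innerₗ (Vec m)))

theorem negSq_apply {m : ℕ} (x : Vec m) : negSq m x = -‖x‖ ^ 2 := by
  simp [negSq, LinearMap.BilinMap.toQuadraticMap_apply]

/-- The real Clifford algebra `ℝ_{0,m}`: every vector `x` satisfies `x² = -|x|²`. -/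
abbrev Cl (m : ℕ) : Type := CliffordAlgebra (negSq m)

/-- The canonical embedding of `ℝ^m` into the Clifford algebra. -/
abbrev vecCl {m : ℕ} : Vec m →ₗ[ℝ] Cl m := CliffordAlgebra.ι (negSq m)

/-- The generator `e_j`. -/
def e {m : ℕ} (j : Fin m) : Cl m := vecCl (EuclideanSpace.single j (1 : ℝ))

/-- The product `e_A = e_{j₁} ⋯ e_{j_k}` for `A = {j₁ < ⋯ < j_k}`. -/
def eProd {m : ℕ} (A : Finset (Fin m)) : Cl m := (A.sort.map e).prod

/-- The standard basis of `ℝ^m`. -/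
abbrev stdB (m : ℕ) : Module.Basis (Fin m) ℝ (Vec m) := (EuclideanSpace.basisFun (Fin m) ℝ).toBasis

theorem contractLeft_list {m : ℕ} (d : Module.Dual ℝ (Vec m)) (l : List (Fin m))
    (hl : ∀ j ∈ l, d (stdB m j) = 0) :
    CliffordAlgebra.contractLeft d
      ((l.map fun j => ExteriorAlgebra.ι ℝ (stdB m j)).prod : ExteriorAlgebra ℝ (Vec m)) = 0 := by
  induction l with
  | nil => exact CliffordAlgebra.contractLeft_one (Q := (0 : QuadraticForm ℝ (Vec m))) d
  | cons i l ih =>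
    rw [List.map_cons, List.prod_cons]
    refine (CliffordAlgebra.contractLeft_ι_mul (Q := (0 : QuadraticForm ℝ (Vec m))) d _ _).trans ?_
    rw [hl i (by simp), ih fun j hj => hl j (by simp [hj])]
    simp

theorem equivExterior_list {m : ℕ} (l : List (Fin m)) (hl : l.Nodup) :
    CliffordAlgebra.equivExterior (negSq m) (l.map e).prod
      = (l.map fun j => ExteriorAlgebra.ι ℝ (stdB m j)).prod := by
  induction l with
  | nil =>
    exact CliffordAlgebra.changeForm_one CliffordAlgebra.changeForm.associated_neg_proof
  | cons i l ih =>
    rw [List.nodup_cons] at hl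
    rw [List.map_cons, List.prod_cons, List.map_cons, List.prod_cons]
    refine (CliffordAlgebra.changeForm_ι_mul
      CliffordAlgebra.changeForm.associated_neg_proof _ _).trans ?_
    have ih' := ih hl.2
    simp only [CliffordAlgebra.equivExterior, CliffordAlgebra.changeFormEquiv_apply] at ih'
    rw [ih']
    refine (congrArg₂ (· - ·) ?_ (contractLeft_list _ l ?_)).trans (sub_zero _)
    · simp [ExteriorAlgebra.ι, EuclideanSpace.basisFun_apply]
    · intro j hj
      have hij : i ≠ j := fun h => hl.1 (h ▸ hj)
      have h2 : QuadraticMap.polar (negSq m) (EuclideanSpace.single i (1 : ℝ))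
          (EuclideanSpace.single j (1 : ℝ)) = 0 := by
        simp only [QuadraticMap.polar, negSq_apply, ← real_inner_self_eq_norm_sq,
          real_inner_add_add_self]
        simp [EuclideanSpace.inner_single_left, hij]
      simp only [QuadraticMap.polar] at h2
      simp [QuadraticMap.associated_apply]
      linarith

theorem equivExterior_eProd {m : ℕ} (A : Finset (Fin m)) :
    CliffordAlgebra.equivExterior (negSq m) (eProd A) = (stdB m).ExteriorAlgebra A := by
  rw [eProd, equivExterior_list _ (Finset.sort_nodup _ _), ExteriorAlgebra.basis_apply]
  refine Eq.trans ?_ (ExteriorAlgebra.ιMulti_apply _).symm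
  congr 1
  apply List.ext_getElem
  · simp
  · intro n h1 h2
    simp
    rfl

/-- The standard basis `(e_A)` of the Clifford algebra. -/
def clBasis (m : ℕ) : Module.Basis (Finset (Fin m)) ℝ (Cl m) :=
  (stdB m).ExteriorAlgebra.map (CliffordAlgebra.equivExterior (negSq m)).symm

theorem clBasis_apply {m : ℕ} (A : Finset (Fin m)) : clBasis m A = eProd A := by
  rw [clBasis, Module.Basis.map_apply, ← equivExterior_eProd, LinearEquiv.symm_apply_apply]

/-- The coordinates `(a_A)` of a Clifford number `a = ∑_A a_A e_A`. -/
def coords (m : ℕ) : Cl m →ₗ[ℝ] EuclideanSpace ℝ (Finset (Fin m)) :=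
  (WithLp.linearEquiv 2 ℝ (Finset (Fin m) → ℝ)).symm.toLinearMap ∘ₗ
    (clBasis m).equivFun.toLinearMap

theorem coords_injective (m : ℕ) : Function.Injective (coords m) :=
  (WithLp.linearEquiv 2 ℝ (Finset (Fin m) → ℝ)).symm.injective.comp (clBasis m).equivFun.injective

/-- The norm `|a|² = ∑_A a_A²` on the Clifford algebra. -/
instance (m : ℕ) : NormedAddCommGroup (Cl m) :=
  NormedAddCommGroup.induced (Cl m) (EuclideanSpace ℝ (Finset (Fin m))) (coords m)
    (coords_injective m)

instance (m : ℕ) : NormedSpace ℝ (Cl m) :=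
  NormedSpace.induced ℝ (Cl m) (EuclideanSpace ℝ (Finset (Fin m))) (coords m)

theorem norm_sq_eq {m : ℕ} (a : Cl m) : ‖a‖ ^ 2 = ∑ A, (clBasis m).repr a A ^ 2 := by
  change ‖coords m a‖ ^ 2 = _
  simp [EuclideanSpace.norm_sq_eq, coords]

/-! ### Monogenic functions -/

/-- The vector part `(x₁, …, x_m)` of `x = (x₀, x₁, …, x_m) ∈ ℝ^{m+1}`. -/
def vecPart {m : ℕ} (x : Vec (m + 1)) : Vec m := WithLp.toLp 2 fun j => x j.succ

/-- The Dirac operator `∑_{j=1}^m e_j ∂_{x_j}` on `ℝ^m`, acting from the left. -/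
def dirac {m : ℕ} (f : Vec m → Cl m) : Vec m → Cl m := fun x =>
  ∑ j : Fin m, e j * fderiv ℝ f x (EuclideanSpace.single j (1 : ℝ))

/-- The generalized Cauchy-Riemann operator `∂_{x₀} + ∑_{j=1}^m e_j ∂_{x_j}` on `ℝ^{m+1}`,
acting from the left. -/
def cauchyRiemann {m : ℕ} (f : Vec (m + 1) → Cl m) : Vec (m + 1) → Cl m := fun x =>
  fderiv ℝ f x (EuclideanSpace.single 0 (1 : ℝ)) +
    ∑ j : Fin m, e j * fderiv ℝ f x (EuclideanSpace.single j.succ (1 : ℝ))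

/-- `f` is (left) monogenic in the open set `Ω ⊆ ℝ^{m+1}`. -/
def MonogenicOn {m : ℕ} (f : Vec (m + 1) → Cl m) (Ω : Set (Vec (m + 1))) : Prop :=
  ContDiffOn ℝ 1 f Ω ∧ ∀ x ∈ Ω, cauchyRiemann f x = 0

/-- `P` is a polynomial function on `ℝ^m` with coefficients in the Clifford algebra. -/
def IsPolynomial {m : ℕ} (P : Vec m → Cl m) : Prop :=
  ∃ c : (Fin m →₀ ℕ) →₀ Cl m, ∀ y, P y = c.sum fun α a => (∏ j, y j ^ α j) • a

/-- `P` is a homogeneous (left) monogenic polynomial of degree `k` in `ℝ^m`. -/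
structure IsHomogeneousMonogenic {m : ℕ} (k : ℕ) (P : Vec m → Cl m) : Prop where
  isPolynomial : IsPolynomial P
  dirac_eq_zero : ∀ y, dirac P y = 0
  homogeneous : ∀ (t : ℝ) (y : Vec m), P (t • y) = t ^ k • P y

/-! ### The Cauchy-Kowalevski extension and Fueter's map -/

/-- The `n`-th term `((-x₀)^n / n!) ∂^n f` of the series of the Cauchy-Kowalevski extension,
`∂` being the Dirac operator on `ℝ^m`. -/
def ckTerm {m : ℕ} (f : Vec m → Cl m) (x : Vec (m + 1)) (n : ℕ) : Cl m :=
  ((-x 0) ^ n / (n.factorial : ℝ)) • (dirac^[n] f) (vecPart x)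

/-- The Cauchy-Kowalevski extension of `f`. -/
def CK {m : ℕ} (f : Vec m → Cl m) (x : Vec (m + 1)) : Cl m := ∑' n, ckTerm f x n

/-- The axial function `(u(x₀, r) + ω v(x₀, r)) P` with `f = u + i v`, `r` the norm of the vector
part of `x` and `ω = (vector part) / r`. Where `r = 0` the term with `ω` is `0`. -/
def axial {m : ℕ} (f : ℂ → ℂ) (P : Vec m → Cl m) (x : Vec (m + 1)) : Cl m :=
  (algebraMap ℝ (Cl m) (f ⟨x 0, ‖vecPart x‖⟩).re +
    (f ⟨x 0, ‖vecPart x‖⟩).im • vecCl (‖vecPart x‖⁻¹ • vecPart x)) * P (vecPart x)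

/-- Fueter's map `Ft[f, P] = Δ^{k + (m - 1) / 2} [(u + ω v) P]`, for `m` odd and `P` of degree `k`,
`Δ` being the Laplacian of `ℝ^{m+1}`. -/
def Ft {m : ℕ} (k : ℕ) (f : ℂ → ℂ) (P : Vec m → Cl m) : Vec (m + 1) → Cl m :=
  (Laplacian.laplacian (E := Vec (m + 1) → Cl m))^[k + (m - 1) / 2] (axial f P)

end Fueter

end

open Fueter

/-!
Write `Q_b(y) = y ^ b * P(y)` and `2N = 2k + m - 1`. By Euler's identity and the Clifford relations,
the Dirac operator `D` on `ℝ^m` maps `Q_b` to `-β_b Q_{b-1}`, with `β_b = b` for even `b` and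
`β_b = b + 2N` for odd `b` (`dirac_vecCl_pow_mul`). After division by `[b]! = β_1 ⋯ β_b` it is minus
a shift (`dirac_dividedPow_succ`), just as `∂₀` is a shift on the `x₀ ^ a / a!`. Hence on a sum
`∑_{a + b = n} w_b (x₀ ^ a / a!) Q_b / [b]!` the Laplacian `∂₀² - D²` replaces the coefficients `w_b`
by `w_b - w_{b+2}` and `n` by `n - 2` (`laplacian_separatedSum_add_two`). Such a sum with constant
coefficients is monogenic, and it is `CK[Q_n]` up to the factor `[n]!` (`hasSum_ckTerm`).

For `f(z) = z ^ n` the axial function is `(x₀ + y) ^ n * P(y)` (`complexToCl_pow`), that is, such a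
sum with `w_b = n! [b]! / b!`. The point is that `[b]! / b!` is a polynomial of degree `N` in
`⌈b / 2⌉`, namely a multiple of `∏_{i < N} (2⌈b / 2⌉ + 1 + 2i)` (`diracFactorial_div_factorial`). So
its `N`-th difference is constant, and `Δ ^ N` maps `(x₀ + y) ^ n * P(y)` to a multiple of
`CK[Q_{n-2N}]`, or to `0` if `n < 2N` (`iterate_laplacian_paravector_pow`).

For an entire series `∑ c_n z ^ n` it remains to differentiate termwise. The derivatives of
`(x₀ + y) ^ n * P(y)` up to a given order grow at most geometrically in `n` on bounded sets
(`exists_geometric_bound`), so all derived series converge normally on bounded sets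
(`SmoothSummable`), and both `Δ ^ N` and the Cauchy-Riemann operator act term by term.
-/

namespace Fueter

open scoped ContDiff

/-! ### Termwise differentiation of series of smooth functions -/

section Series

variable {E F G : Type*} [NormedAddCommGroup E] [NormedSpace ℝ E] [NormedAddCommGroup F]
  [NormedSpace ℝ F] [NormedAddCommGroup G] [NormedSpace ℝ G]

/-- A series of smooth functions all of whose derivatives converge normally on bounded sets. -/
structure SmoothSummable (f : ℕ → E → F) : Prop where
  contDiff : ∀ n, ContDiff ℝ ∞ (f n)
  bound : ∀ (k : ℕ) (R : ℝ), ∃ u : ℕ → ℝ, Summable u ∧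
    ∀ n x, ‖x‖ < R → ‖iteratedFDeriv ℝ k (f n) x‖ ≤ u n

namespace SmoothSummable

variable {f : ℕ → E → F}

theorem differentiable (hf : SmoothSummable f) (n : ℕ) : Differentiable ℝ (f n) :=
  (hf.contDiff n).differentiable (by simp)

theorem summable [CompleteSpace F] (hf : SmoothSummable f) (x : E) :
    Summable fun n => f n x := by
  obtain ⟨u, hu, h⟩ := hf.bound 0 (‖x‖ + 1)
  exact .of_norm_bounded hu fun n => by simpa using h n x (by linarith)

theorem fderiv (hf : SmoothSummable f) : SmoothSummable fun n => fderiv ℝ (f n) where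
  contDiff n := (hf.contDiff n).fderiv_right (by simp)
  bound k R := by
    obtain ⟨u, hu, h⟩ := hf.bound (k + 1) R
    exact ⟨u, hu, fun n x hx => by rw [norm_iteratedFDeriv_fderiv]; exact h n x hx⟩

theorem clm_comp (hf : SmoothSummable f) (L : F →L[ℝ] G) :
    SmoothSummable fun n x => L (f n x) where
  contDiff n := L.contDiff.comp (hf.contDiff n)
  bound k R := by
    obtain ⟨u, hu, h⟩ := hf.bound k R
    refine ⟨fun n => ‖L‖ * u n, hu.mul_left _, fun n x hx => ?_⟩
    exact (L.norm_iteratedFDeriv_comp_left (hf.contDiff n).contDiffAt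
      (by exact_mod_cast le_top)).trans (mul_le_mul_of_nonneg_left (h n x hx) (norm_nonneg L))

theorem hasFDerivAt_tsum [CompleteSpace F] (hf : SmoothSummable f) (x : E) :
    HasFDerivAt (fun y => ∑' n, f n y) (∑' n, _root_.fderiv ℝ (f n) x) x := by
  obtain ⟨u, hu, h⟩ := hf.bound 1 (‖x‖ + 1)
  have hx : x ∈ Metric.ball (0 : E) (‖x‖ + 1) := by simp
  refine hasFDerivAt_tsum_of_isPreconnected hu Metric.isOpen_ball
    (convex_ball (0 : E) _).isPreconnected (fun n y _ => (hf.differentiable n y).hasFDerivAt)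
    (fun n y hy => ?_) hx (hf.summable x) hx
  rw [← norm_iteratedFDeriv_one]
  exact h n y (by simpa using hy)

theorem fderiv_tsum [CompleteSpace F] (hf : SmoothSummable f) :
    _root_.fderiv ℝ (fun y => ∑' n, f n y) = fun x => ∑' n, _root_.fderiv ℝ (f n) x :=
  funext fun x => (hf.hasFDerivAt_tsum x).fderiv

theorem contDiff_one_tsum [CompleteSpace F] (hf : SmoothSummable f) :
    ContDiff ℝ 1 fun y => ∑' n, f n y := by
  rw [contDiff_one_iff_fderiv, hf.fderiv_tsum]
  exact ⟨fun x => (hf.hasFDerivAt_tsum x).differentiableAt,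
    continuous_iff_continuousAt.2 fun x => (hf.fderiv.hasFDerivAt_tsum x).continuousAt⟩

end SmoothSummable

/-- The trace `B ↦ ∑ᵢ B(eᵢ, eᵢ)` of a bilinear map with respect to an orthonormal basis. -/
noncomputable def bilinTrace {V ι : Type*} [NormedAddCommGroup V] [InnerProductSpace ℝ V] [Fintype ι]
    (b : OrthonormalBasis ι ℝ V) (F : Type*) [NormedAddCommGroup F] [NormedSpace ℝ F] :
    (V →L[ℝ] V →L[ℝ] F) →L[ℝ] F :=
  ∑ i, (ContinuousLinearMap.apply ℝ F (b i)).comp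
    (ContinuousLinearMap.apply ℝ (V →L[ℝ] F) (b i))

section Laplacian

variable {V ι : Type*} [NormedAddCommGroup V] [InnerProductSpace ℝ V] [FiniteDimensional ℝ V]
  [Fintype ι]

theorem laplacian_eq_bilinTrace (b : OrthonormalBasis ι ℝ V) (f : V → F) :
    Laplacian.laplacian f = fun x => bilinTrace b F (fderiv ℝ (fderiv ℝ f) x) := by
  rw [InnerProductSpace.laplacian_eq_iteratedFDeriv_orthonormalBasis f b]
  funext x
  simp [bilinTrace, iteratedFDeriv_two_apply]

theorem SmoothSummable.laplacian {f : ℕ → V → F} (hf : SmoothSummable f) :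
    SmoothSummable fun n => Laplacian.laplacian (f n) := by
  simp only [laplacian_eq_bilinTrace (stdOrthonormalBasis ℝ V)]
  exact hf.fderiv.fderiv.clm_comp _

theorem SmoothSummable.laplacian_tsum [CompleteSpace F] {f : ℕ → V → F} (hf : SmoothSummable f) :
    Laplacian.laplacian (fun x => ∑' n, f n x) = fun x => ∑' n, Laplacian.laplacian (f n) x := by
  simp only [laplacian_eq_bilinTrace (stdOrthonormalBasis ℝ V), hf.fderiv_tsum,
    hf.fderiv.fderiv_tsum]
  funext x
  exact ContinuousLinearMap.map_tsum _ (hf.fderiv.fderiv.summable x)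

theorem SmoothSummable.iterate_laplacian {f : ℕ → V → F} (hf : SmoothSummable f) (s : ℕ) :
    SmoothSummable fun n => (Laplacian.laplacian (E := V → F))^[s] (f n) := by
  induction s with
  | zero => exact hf
  | succ s ih => simpa only [Function.iterate_succ_apply'] using ih.laplacian

theorem SmoothSummable.iterate_laplacian_tsum [CompleteSpace F] {f : ℕ → V → F}
    (hf : SmoothSummable f) (s : ℕ) :
    (Laplacian.laplacian (E := V → F))^[s] (fun x => ∑' n, f n x) =
      fun x => ∑' n, (Laplacian.laplacian (E := V → F))^[s] (f n) x := by
  induction s with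
  | zero => rfl
  | succ s ih =>
    simp only [Function.iterate_succ_apply', ih]
    exact (hf.iterate_laplacian s).laplacian_tsum

end Laplacian

/-- The derivatives of order at most `K` of the iterated products `X * (X * (⋯ * g))` grow at most
geometrically with the number of factors, uniformly on bounded sets. -/
theorem exists_geometric_bound [FiniteDimensional ℝ E] (B : F →L[ℝ] F →L[ℝ] F) {X : E → F}
    (hX : ContDiff ℝ ∞ X) (f : ℕ → E → F) (h0 : ContDiff ℝ ∞ (f 0))
    (hs : ∀ n x, f (n + 1) x = B (X x) (f n x)) :
    (∀ n, ContDiff ℝ ∞ (f n)) ∧ ∀ (K : ℕ) (R : ℝ), ∃ M C : ℝ, 0 ≤ M ∧ 0 ≤ C ∧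
      ∀ n, ∀ k ≤ K, ∀ x, ‖x‖ < R → ‖iteratedFDeriv ℝ k (f n) x‖ ≤ C * M ^ n := by
  have hsm : ∀ n, ContDiff ℝ ∞ (f n) := by
    intro n
    induction n with
    | zero => exact h0
    | succ n ih =>
      rw [show f (n + 1) = fun x => B (X x) (f n x) from funext (hs n)]
      exact (B.contDiff.comp hX).clm_apply ih
  -- On a closed ball the derivatives up to order `K` of a smooth function are bounded.
  have hbd : ∀ (K : ℕ) (R : ℝ) (g : E → F), ContDiff ℝ ∞ g → ∃ C : ℝ, 0 ≤ C ∧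
      ∀ k ≤ K, ∀ x, ‖x‖ < R → ‖iteratedFDeriv ℝ k g x‖ ≤ C := by
    intro K R g hg
    have h1 : ∀ k : ℕ, ∃ C : ℝ, ∀ x ∈ Metric.closedBall (0 : E) R,
        ‖iteratedFDeriv ℝ k g x‖ ≤ C := fun k => by
      have := FiniteDimensional.proper_real E
      exact (isCompact_closedBall (0 : E) R).exists_bound_of_continuousOn
        (hg.continuous_iteratedFDeriv (by exact_mod_cast le_top)).continuousOn
    choose C hC using h1
    refine ⟨∑ k ∈ Finset.range (K + 1), |C k|, Finset.sum_nonneg fun _ _ => abs_nonneg _,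
      fun k hk x hx => ?_⟩
    refine (hC k x (by simpa using hx.le)).trans ((le_abs_self _).trans ?_)
    exact Finset.single_le_sum (f := fun k => |C k|) (fun _ _ => abs_nonneg _)
      (Finset.mem_range.2 (by omega))
  refine ⟨hsm, fun K R => ?_⟩
  obtain ⟨A, hA0, hA⟩ := hbd K R X hX
  obtain ⟨C, hC0, hC⟩ := hbd K R (f 0) h0
  refine ⟨‖B‖ * (2 ^ K * A), C, by positivity, hC0, fun n => ?_⟩
  induction n with
  | zero => simpa using hC
  | succ n ih =>
    intro k hk x hx
    rw [show f (n + 1) = fun x => B (X x) (f n x) from funext (hs n)]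
    refine (B.norm_iteratedFDeriv_le_of_bilinear hX (hsm n) x (n := k)
      (by exact_mod_cast le_top)).trans ?_
    have h2 : ∑ i ∈ Finset.range (k + 1), (k.choose i : ℝ) * ‖iteratedFDeriv ℝ i X x‖ *
        ‖iteratedFDeriv ℝ (k - i) (f n) x‖ ≤ 2 ^ K * A * (C * (‖B‖ * (2 ^ K * A)) ^ n) := by
      calc _ ≤ ∑ i ∈ Finset.range (k + 1), (k.choose i : ℝ) *
            (A * (C * (‖B‖ * (2 ^ K * A)) ^ n)) := by
            refine Finset.sum_le_sum fun i hi => ?_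
            rw [mul_assoc]
            have hi' := Finset.mem_range.1 hi
            gcongr
            · exact hA i (by omega) x hx
            · exact ih (k - i) (by omega) x hx
        _ = 2 ^ k * A * (C * (‖B‖ * (2 ^ K * A)) ^ n) := by
            rw [← Finset.sum_mul, mul_assoc]
            congr 1
            exact_mod_cast Nat.sum_range_choose k
        _ ≤ _ := by
            gcongr
            norm_num
    calc _ ≤ ‖B‖ * (2 ^ K * A * (C * (‖B‖ * (2 ^ K * A)) ^ n)) := by gcongr
      _ = _ := by ring

/-- The decay of the coefficients of an entire power series beats the geometric growth of the
derivatives in `exists_geometric_bound`. -/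
theorem smoothSummable_smul_of_bilin [FiniteDimensional ℝ E] (B : F →L[ℝ] F →L[ℝ] F) {X : E → F}
    (hX : ContDiff ℝ ∞ X) (f : ℕ → E → F) (h0 : ContDiff ℝ ∞ (f 0))
    (hs : ∀ n x, f (n + 1) x = B (X x) (f n x)) (c : ℕ → ℝ)
    (hc : ∀ M : ℝ, 0 ≤ M → Summable fun n => |c n| * M ^ n) :
    SmoothSummable fun n x => c n • f n x := by
  obtain ⟨hsm, hb⟩ := exists_geometric_bound B hX f h0 hs
  refine ⟨fun n => (hsm n).const_smul _, fun k R => ?_⟩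
  obtain ⟨M, C, hM, hC, h⟩ := hb k R
  refine ⟨fun n => C * (|c n| * M ^ n), (hc M hM).mul_left C, fun n x hx => ?_⟩
  rw [iteratedFDeriv_const_smul_apply' ((hsm n).contDiffAt.of_le (by exact_mod_cast le_top)),
    norm_smul, Real.norm_eq_abs]
  calc _ ≤ |c n| * (C * M ^ n) := by gcongr; exact h n k le_rfl x hx
    _ = _ := by ring

end Series

variable {m : ℕ}

/-! ### Clifford relations and linear maps -/

instance finiteDimensional_cl (m : ℕ) : FiniteDimensional ℝ (Cl m) :=
  Module.Finite.of_basis (clBasis m)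

/-- Multiplication of the Clifford algebra as a continuous bilinear map. -/
noncomputable def mulL (m : ℕ) : Cl m →L[ℝ] Cl m →L[ℝ] Cl m :=
  (LinearMap.mul ℝ (Cl m)).toContinuousBilinearMap

@[simp] theorem mulL_apply (a b : Cl m) : mulL m a b = a * b := rfl

/-- The embedding of `ℝ^m` into the Clifford algebra as a continuous linear map. -/
noncomputable def vecClL (m : ℕ) : Vec m →L[ℝ] Cl m := LinearMap.toContinuousLinearMap vecCl

@[simp] theorem vecClL_apply (y : Vec m) : vecClL m y = vecCl y := rfl

/-- The projection `(x₀, y) ↦ y` as a continuous linear map. -/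
noncomputable def vecPartL (m : ℕ) : Vec (m + 1) →L[ℝ] Vec m :=
  LinearMap.toContinuousLinearMap
    { toFun := vecPart
      map_add' := fun x y => by ext; simp [vecPart]
      map_smul' := fun c x => by ext; simp [vecPart] }

@[simp] theorem vecPartL_apply (x : Vec (m + 1)) : vecPartL m x = vecPart x := rfl

theorem vecPart_single_zero (t : ℝ) :
    vecPart (EuclideanSpace.single (0 : Fin (m + 1)) t) = 0 := by
  ext j; simp [vecPart]

theorem vecPart_single_succ (j : Fin m) (t : ℝ) :
    vecPart (EuclideanSpace.single j.succ t) = EuclideanSpace.single j t := by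
  ext i; simp [vecPart]

theorem vecCl_mul_self (y : Vec m) : vecCl y * vecCl y = algebraMap ℝ (Cl m) (-‖y‖ ^ 2) := by
  rw [CliffordAlgebra.ι_sq_scalar, negSq_apply]

theorem vecCl_mul_add_swap (y z : Vec m) :
    vecCl y * vecCl z + vecCl z * vecCl y = algebraMap ℝ (Cl m) (-2 * inner ℝ y z) := by
  rw [CliffordAlgebra.ι_mul_ι_add_swap]
  congr 1
  simp only [QuadraticMap.polar, negSq_apply, norm_add_sq_real]
  ring

theorem e_mul_add_swap (i j : Fin m) :
    (e i * e j + e j * e i : Cl m) = if i = j then -2 else 0 := by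
  rw [e, e, vecCl_mul_add_swap]
  by_cases h : i = j
  · subst h; simp [map_ofNat]
  · simp [EuclideanSpace.inner_single_left, h]

theorem e_mul_self (i : Fin m) : (e i * e i : Cl m) = -1 := by
  rw [e, vecCl_mul_self]; simp

theorem e_mul_vecCl (j : Fin m) (y : Vec m) :
    e j * vecCl y = -(vecCl y * e j) - algebraMap ℝ (Cl m) (2 * y j) := by
  have h := vecCl_mul_add_swap (EuclideanSpace.single j (1 : ℝ)) y
  rw [EuclideanSpace.inner_single_left] at h
  rw [e, ← sub_eq_zero]
  calc _ = vecCl (EuclideanSpace.single j 1) * vecCl y + vecCl y * vecCl (EuclideanSpace.single j 1)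
        + algebraMap ℝ (Cl m) (2 * y j) := by abel
    _ = 0 := by rw [h, ← map_add]; simp

theorem sum_smul_single (y : Vec m) :
    ∑ j, y j • (EuclideanSpace.single j (1 : ℝ) : Vec m) = y := by
  simpa using (EuclideanSpace.basisFun (Fin m) ℝ).sum_repr y

/-! ### The Dirac operator on products `y ^ b * P` -/

theorem dirac_const_smul (c : ℝ) (f : Vec m → Cl m) (hf : Differentiable ℝ f) :
    dirac (fun y => c • f y) = fun y => c • dirac f y := by
  funext y
  simp [dirac, fderiv_fun_const_smul (hf y), Finset.smul_sum]

/-- The anticommutation of the Dirac operator with multiplication by the vector variable, up to the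
Euler operator and the dimension. -/
theorem dirac_vecCl_mul {h : Vec m → Cl m} (hh : Differentiable ℝ h) (y : Vec m) :
    dirac (fun z => vecCl z * h z) y =
      -(m : ℝ) • h y - (2 : ℝ) • fderiv ℝ h y y - vecCl y * dirac h y := by
  have hd : HasFDerivAt (fun z => vecCl z * h z)
      ((mulL m).precompR _ (vecClL m y) (fderiv ℝ h y) +
        (mulL m).precompL _ (vecClL m) (h y)) y :=
    (mulL m).hasFDerivAt_of_bilinear (vecClL m).hasFDerivAt (hh y).hasFDerivAt
  have hy : fderiv ℝ h y y = ∑ j, y j • fderiv ℝ h y (EuclideanSpace.single j 1) := by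
    simpa using congrArg (fderiv ℝ h y) (sum_smul_single y).symm
  have hterm : ∀ j : Fin m, e j * (vecCl y * fderiv ℝ h y (EuclideanSpace.single j 1) +
      vecCl (EuclideanSpace.single j 1) * h y) = - h y -
        (2 : ℝ) • (y j • fderiv ℝ h y (EuclideanSpace.single j 1)) -
          vecCl y * (e j * fderiv ℝ h y (EuclideanSpace.single j 1)) := by
    intro j
    rw [mul_add, ← mul_assoc, e_mul_vecCl, ← mul_assoc, ← e, e_mul_self, sub_mul, smul_smul,
      Algebra.smul_def]
    noncomm_ring
  simp only [dirac, hd.fderiv]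
  refine (Finset.sum_congr rfl fun j _ => hterm j).trans ?_
  simp only [hy, Finset.sum_sub_distrib, Finset.smul_sum, Finset.mul_sum]
  congr 2
  simp [← Nat.cast_smul_eq_nsmul ℝ]

/-- Euler's identity for homogeneous functions. -/
theorem fderiv_apply_self_of_homogeneous {E F : Type*} [NormedAddCommGroup E] [NormedSpace ℝ E]
    [NormedAddCommGroup F] [NormedSpace ℝ F] {h : E → F} {d : ℕ}
    (hh : ∀ (t : ℝ) y, h (t • y) = t ^ d • h y) {y : E} (hd : DifferentiableAt ℝ h y) :
    fderiv ℝ h y y = (d : ℝ) • h y := by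
  have h1 : HasDerivAt (fun t : ℝ => h (t • y)) (fderiv ℝ h y y) 1 := by
    have hl : HasDerivAt (fun t : ℝ => t • y) y 1 := by
      simpa using (hasDerivAt_id (1 : ℝ)).smul_const y
    refine HasFDerivAt.comp_hasDerivAt (1 : ℝ) (l := h) ?_ hl
    rw [one_smul]
    exact hd.hasFDerivAt
  have h2 : HasDerivAt (fun t : ℝ => t ^ d • h y) ((d : ℝ) • h y) 1 := by
    simpa using (hasDerivAt_pow d (1 : ℝ)).smul_const (h y)
  simp only [hh] at h1
  exact h1.unique h2

theorem IsPolynomial.contDiff {P : Vec m → Cl m} (hP : IsPolynomial P) : ContDiff ℝ ∞ P := by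
  obtain ⟨c, hc⟩ := hP
  rw [funext hc]
  unfold Finsupp.sum
  fun_prop

/-- The number `β` with `∂ (y ^ b * P) = -β • (y ^ (b - 1) * P)` for `P` homogeneous monogenic of
degree `k`. -/
noncomputable def diracCoeff (m k b : ℕ) : ℝ := if Even b then b else b + (2 * k + m - 1)

/-- The product of the first `b` numbers `diracCoeff`, a deformation of `b!`. -/
noncomputable def diracFactorial (m k b : ℕ) : ℝ := ∏ i ∈ Finset.range b, diracCoeff m k (i + 1)

theorem diracCoeff_pos (hm : 0 < m) (k b : ℕ) : 0 < diracCoeff m k (b + 1) := by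
  unfold diracCoeff
  have : (1 : ℝ) ≤ m := by exact_mod_cast hm
  split_ifs
  · positivity
  · have : (0 : ℝ) ≤ 2 * k := by positivity
    push_cast
    linarith [(Nat.cast_nonneg b : (0 : ℝ) ≤ b)]

theorem diracFactorial_ne_zero (hm : 0 < m) (k b : ℕ) : diracFactorial m k b ≠ 0 :=
  Finset.prod_ne_zero_iff.2 fun i _ => (diracCoeff_pos hm k i).ne'

theorem diracCoeff_succ (m k b : ℕ) :
    diracCoeff m k (b + 1) = m + 2 * (b + k) - diracCoeff m k b := by
  unfold diracCoeff
  rcases Nat.even_or_odd b with h | h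
  · rw [if_neg (by simpa using h.add_one), if_pos h]; push_cast; ring
  · rw [if_pos h.add_one, if_neg (by simpa using h)]; push_cast; ring

section Powers

variable {k : ℕ} {P : Vec m → Cl m}

theorem contDiff_vecCl_pow_mul (hP : IsHomogeneousMonogenic k P) (b : ℕ) :
    ContDiff ℝ ∞ fun y => vecCl y ^ b * P y := by
  induction b with
  | zero => simpa using hP.isPolynomial.contDiff
  | succ b ih =>
    have : (fun y => vecCl y ^ (b + 1) * P y) =
        fun y => mulL m (vecClL m y) (vecCl y ^ b * P y) := by
      funext y; simp [pow_succ', mul_assoc]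
    rw [this]
    exact ((mulL m).contDiff.comp (vecClL m).contDiff).clm_apply ih

/-- The truncated exponent `b - 1` is harmless at `b = 0`, where the coefficient vanishes. -/
theorem dirac_vecCl_pow_mul (hP : IsHomogeneousMonogenic k P) (b : ℕ) :
    dirac (fun y => vecCl y ^ b * P y) =
      fun y => -(diracCoeff m k b) • (vecCl y ^ (b - 1) * P y) := by
  induction b with
  | zero => funext y; simpa [diracCoeff] using hP.dirac_eq_zero y
  | succ b ih =>
    funext y
    have hd : Differentiable ℝ fun y => vecCl y ^ b * P y :=
      (contDiff_vecCl_pow_mul hP b).differentiable (by simp)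
    have hhom : ∀ (t : ℝ) y, vecCl (t • y) ^ b * P (t • y) =
        t ^ (b + k) • (vecCl y ^ b * P y) := by
      intro t y
      rw [hP.homogeneous, map_smul, smul_pow, smul_mul_smul_comm, pow_add]
    have h1 : (fun y => vecCl y ^ (b + 1) * P y) = fun y => vecCl y * (vecCl y ^ b * P y) := by
      funext y; rw [pow_succ', mul_assoc]
    -- `y * y ^ (b - 1)` is not `y ^ b` for `b = 0`, but then the coefficient vanishes.
    have h2 : diracCoeff m k b • (vecCl y * (vecCl y ^ (b - 1) * P y)) =
        diracCoeff m k b • (vecCl y ^ b * P y) := by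
      rcases b with _ | b
      · simp [diracCoeff]
      · rw [Nat.add_sub_cancel, ← mul_assoc, ← pow_succ']
    rw [h1, dirac_vecCl_mul hd, fderiv_apply_self_of_homogeneous hhom (hd y), ih, mul_smul_comm,
      neg_smul (diracCoeff m k b), h2, diracCoeff_succ, Nat.add_sub_cancel]
    push_cast
    module

/-- The normalization of `y ^ b * P` for which the Dirac operator is, up to sign, a shift. -/
noncomputable def dividedPow (m k : ℕ) (P : Vec m → Cl m) (b : ℕ) (y : Vec m) : Cl m :=
  (diracFactorial m k b)⁻¹ • (vecCl y ^ b * P y)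

theorem contDiff_dividedPow (hP : IsHomogeneousMonogenic k P) (b : ℕ) :
    ContDiff ℝ ∞ (dividedPow m k P b) :=
  (contDiff_vecCl_pow_mul hP b).const_smul _

theorem dirac_dividedPow_zero (hP : IsHomogeneousMonogenic k P) :
    dirac (dividedPow m k P 0) = 0 := by
  unfold dividedPow
  rw [dirac_const_smul _ _ ((contDiff_vecCl_pow_mul hP 0).differentiable (by simp)),
    dirac_vecCl_pow_mul hP]
  funext y
  simp [diracCoeff]

theorem dirac_dividedPow_succ (hm : 0 < m) (hP : IsHomogeneousMonogenic k P) (b : ℕ) :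
    dirac (dividedPow m k P (b + 1)) = fun y => -dividedPow m k P b y := by
  unfold dividedPow
  rw [dirac_const_smul _ _ ((contDiff_vecCl_pow_mul hP _).differentiable (by simp)),
    dirac_vecCl_pow_mul hP]
  funext y
  have h1 := (diracCoeff_pos hm k b).ne'
  have h2 := diracFactorial_ne_zero hm k b
  rw [smul_smul, Nat.add_sub_cancel, ← neg_smul]
  congr 1
  rw [diracFactorial, Finset.prod_range_succ, ← diracFactorial]
  field_simp

theorem iterate_dirac_dividedPow (hm : 0 < m) (hP : IsHomogeneousMonogenic k P) (n j : ℕ) :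
    dirac^[n] (dividedPow m k P j) =
      fun y => if n ≤ j then (-1 : ℝ) ^ n • dividedPow m k P (j - n) y else 0 := by
  induction n with
  | zero => simp
  | succ n ih =>
    rw [Function.iterate_succ_apply', ih]
    funext y
    by_cases hn : n ≤ j
    · simp only [if_pos hn]
      rw [dirac_const_smul _ _ ((contDiff_dividedPow hP _).differentiable (by simp))]
      rcases hn.lt_or_eq with h | h
      · obtain ⟨i, rfl⟩ := Nat.exists_eq_add_of_lt h
        rw [show n + i + 1 - n = i + 1 by omega, dirac_dividedPow_succ hm hP,
          if_pos (by omega), show n + i + 1 - (n + 1) = i by omega, pow_succ]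
        simp
      · subst h
        simp [dirac_dividedPow_zero hP]
    · simp [hn, show ¬ n + 1 ≤ j by omega, dirac]

end Powers

/-! ### The Cauchy-Riemann operator and the Laplacian -/

/-- The derivative `∂_{x₀}` on `ℝ^{m+1}`. -/
noncomputable def derivZero (f : Vec (m + 1) → Cl m) (x : Vec (m + 1)) : Cl m :=
  fderiv ℝ f x (EuclideanSpace.single 0 (1 : ℝ))

/-- The Dirac operator in the vector variables, acting on functions on `ℝ^{m+1}`. -/
noncomputable def derivVec (f : Vec (m + 1) → Cl m) (x : Vec (m + 1)) : Cl m :=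
  ∑ j : Fin m, e j * fderiv ℝ f x (EuclideanSpace.single j.succ (1 : ℝ))

theorem cauchyRiemann_eq (f : Vec (m + 1) → Cl m) (x : Vec (m + 1)) :
    cauchyRiemann f x = derivZero f x + derivVec f x := rfl

/-- The symbol of the Cauchy-Riemann operator: `cauchyRiemann f x` is its value at `fderiv f x`. -/
noncomputable def cauchyRiemannSymbol (m : ℕ) : (Vec (m + 1) →L[ℝ] Cl m) →L[ℝ] Cl m :=
  ContinuousLinearMap.apply ℝ (Cl m) (EuclideanSpace.single 0 (1 : ℝ)) +
    ∑ j : Fin m, (mulL m (e j)).comp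
      (ContinuousLinearMap.apply ℝ (Cl m) (EuclideanSpace.single j.succ (1 : ℝ)))

theorem cauchyRiemann_eq_symbol (f : Vec (m + 1) → Cl m) (x : Vec (m + 1)) :
    cauchyRiemann f x = cauchyRiemannSymbol m (fderiv ℝ f x) := by
  rw [cauchyRiemannSymbol, add_apply, _root_.sum_apply]
  rfl

theorem derivZero_sum {ι : Type*} (s : Finset ι) (w : ι → ℝ) (f : ι → Vec (m + 1) → Cl m)
    (hf : ∀ i, Differentiable ℝ (f i)) :
    derivZero (fun x => ∑ i ∈ s, w i • f i x) = fun x => ∑ i ∈ s, w i • derivZero (f i) x := by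
  funext x
  simp only [derivZero]
  rw [fderiv_fun_sum (A := fun i x => w i • f i x) fun i _ => ((hf i).const_smul (w i)) x,
    _root_.sum_apply]
  refine Finset.sum_congr rfl fun i _ => ?_
  rw [fderiv_fun_const_smul (hf i x)]
  rfl

theorem derivVec_sum {ι : Type*} (s : Finset ι) (w : ι → ℝ) (f : ι → Vec (m + 1) → Cl m)
    (hf : ∀ i, Differentiable ℝ (f i)) :
    derivVec (fun x => ∑ i ∈ s, w i • f i x) = fun x => ∑ i ∈ s, w i • derivVec (f i) x := by
  funext x
  simp only [derivVec, Finset.smul_sum]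
  rw [Finset.sum_comm]
  refine Finset.sum_congr rfl fun j _ => ?_
  rw [fderiv_fun_sum (A := fun i x => w i • f i x) fun i _ => ((hf i).const_smul (w i)) x,
    _root_.sum_apply, Finset.mul_sum]
  refine Finset.sum_congr rfl fun i _ => ?_
  rw [fderiv_fun_const_smul (hf i x), smul_apply, mul_smul_comm]

theorem fderiv_fderiv_apply {E F : Type*} [NormedAddCommGroup E] [NormedSpace ℝ E]
    [NormedAddCommGroup F] [NormedSpace ℝ F] {f : E → F} (hf : ContDiff ℝ ∞ f) (v w x : E) :
    fderiv ℝ (fun y => fderiv ℝ f y v) x w = fderiv ℝ (fderiv ℝ f) x w v := by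
  have h : DifferentiableAt ℝ (fderiv ℝ f) x :=
    (hf.fderiv_right (m := ∞) (by simp)).differentiable (by simp) x
  rw [fderiv_clm_apply h (differentiableAt_const v)]
  simp

/-- The Laplacian factorizes as `(∂₀ - D)(∂₀ + D)` with `D` the Dirac operator; here the two terms
`∂₀²` and `-D²` are displayed separately. -/
theorem laplacian_eq_derivZero_sub_derivVec {f : Vec (m + 1) → Cl m} (hf : ContDiff ℝ ∞ f) :
    Laplacian.laplacian f = fun x => derivZero (derivZero f) x - derivVec (derivVec f) x := by
  rw [laplacian_eq_bilinTrace (EuclideanSpace.basisFun (Fin (m + 1)) ℝ) f]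
  funext x
  have hsymm : IsSymmSndFDerivAt ℝ f x := hf.contDiffAt.isSymmSndFDerivAt
    (by simpa using WithTop.coe_le_coe.2 (le_top : (2 : ℕ∞) ≤ ⊤))
  have h0 : derivZero (derivZero f) x =
      fderiv ℝ (fderiv ℝ f) x (EuclideanSpace.single 0 1) (EuclideanSpace.single 0 1) :=
    fderiv_fderiv_apply hf _ _ x
  set S : Fin m → Fin m → Cl m := fun i j => fderiv ℝ (fderiv ℝ f) x
    (EuclideanSpace.single i.succ 1) (EuclideanSpace.single j.succ 1) with hS
  have hv : derivVec (derivVec f) x = ∑ i, ∑ j, e i * e j * S i j := by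
    have hd : ∀ (j : Fin m) (y : Vec (m + 1)), DifferentiableAt ℝ
        (fun z => fderiv ℝ f z (EuclideanSpace.single j.succ (1 : ℝ))) y := fun j y =>
      ((hf.fderiv_right (m := ∞) (by simp)).clm_apply contDiff_const).differentiable (by simp) y
    unfold derivVec
    refine Finset.sum_congr rfl fun i _ => ?_
    have h1 : ∀ j : Fin m, HasFDerivAt
        (fun z => e j * fderiv ℝ f z (EuclideanSpace.single j.succ (1 : ℝ)))
        ((mulL m (e j)).comp
          (fderiv ℝ (fun z => fderiv ℝ f z (EuclideanSpace.single j.succ (1 : ℝ))) x)) x :=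
      fun j => (mulL m (e j)).hasFDerivAt.comp x (hd j x).hasFDerivAt
    rw [(HasFDerivAt.fun_sum fun j _ => h1 j).fderiv, _root_.sum_apply,
      Finset.mul_sum]
    refine Finset.sum_congr rfl fun j _ => ?_
    rw [ContinuousLinearMap.comp_apply, fderiv_fderiv_apply hf, mulL_apply, ← mul_assoc]
  -- Symmetrizing in `i`, `j` leaves only the diagonal, by the Clifford relations.
  have hdiag : ∑ i, ∑ j, e i * e j * S i j = -∑ i, S i i := by
    have hsw : ∑ i, ∑ j, e i * e j * S i j = ∑ i, ∑ j, e j * e i * S i j := by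
      rw [Finset.sum_comm]
      refine Finset.sum_congr rfl fun i _ => Finset.sum_congr rfl fun j _ => ?_
      rw [show S j i = S i j from hsymm _ _]
    have h2 : (2 : ℝ) • ∑ i, ∑ j, e i * e j * S i j = (2 : ℝ) • -∑ i, S i i := by
      rw [two_smul]
      nth_rewrite 2 [hsw]
      simp only [← Finset.sum_add_distrib, ← add_mul, e_mul_add_swap]
      simp [ite_mul, two_smul, two_mul, Finset.sum_add_distrib]
    exact smul_right_injective (Cl m) (two_ne_zero (α := ℝ)) h2
  rw [h0, hv, hdiag, sub_neg_eq_add]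
  simp only [bilinTrace, Fin.sum_univ_succ]
  simp [hS]

/-! ### Separated functions `x₀ ^ a / a! • h(vec x)` -/

section Separated

/-- The function `x₀ ^ a / a! • h(y)` of `x = (x₀, y)`. -/
noncomputable def separated (a : ℕ) (h : Vec m → Cl m) (x : Vec (m + 1)) : Cl m :=
  (x 0 ^ a / (a.factorial : ℝ)) • h (vecPart x)

theorem contDiff_separated (a : ℕ) {h : Vec m → Cl m} (hh : ContDiff ℝ ∞ h) :
    ContDiff ℝ ∞ (separated a h) := by
  have h0 : ContDiff ℝ ∞ fun x : Vec (m + 1) => h (vecPart x) := hh.comp (vecPartL m).contDiff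
  unfold separated
  fun_prop

theorem fderiv_separated (a : ℕ) {h : Vec m → Cl m} (hh : Differentiable ℝ h)
    (x v : Vec (m + 1)) : fderiv ℝ (separated a h) x v =
      (x 0 ^ a / (a.factorial : ℝ)) • fderiv ℝ h (vecPart x) (vecPart v) +
        ((a : ℝ) * x 0 ^ (a - 1) / (a.factorial : ℝ) * v 0) • h (vecPart x) := by
  have h1 : HasFDerivAt (fun x : Vec (m + 1) => h (vecPart x))
      ((fderiv ℝ h (vecPart x)).comp (vecPartL m)) x :=
    (hh (vecPart x)).hasFDerivAt.comp x (vecPartL m).hasFDerivAt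
  have h2 : HasFDerivAt (fun x : Vec (m + 1) => x 0 ^ a / (a.factorial : ℝ))
      (((a : ℝ) * x 0 ^ (a - 1) / (a.factorial : ℝ)) •
        (EuclideanSpace.proj (0 : Fin (m + 1)) : Vec (m + 1) →L[ℝ] ℝ)) x :=
    HasDerivAt.comp_hasFDerivAt (h₂ := fun t : ℝ => t ^ a / (a.factorial : ℝ)) x
      ((hasDerivAt_pow a (x 0)).div_const _)
      (EuclideanSpace.proj (0 : Fin (m + 1)) : Vec (m + 1) →L[ℝ] ℝ).hasFDerivAt
  have h3 := h2.smul h1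
  rw [show fderiv ℝ (separated a h) x = _ from h3.fderiv]
  simp

theorem derivZero_separated_zero {h : Vec m → Cl m} (hh : Differentiable ℝ h) :
    derivZero (separated 0 h) = 0 := by
  funext x
  simp [derivZero, fderiv_separated 0 hh, vecPart_single_zero]

theorem derivZero_separated_succ (a : ℕ) {h : Vec m → Cl m} (hh : Differentiable ℝ h) :
    derivZero (separated (a + 1) h) = separated a h := by
  funext x
  simp only [derivZero, fderiv_separated _ hh, vecPart_single_zero, map_zero, smul_zero, zero_add,
    separated]
  congr 1
  rw [Nat.factorial_succ, Nat.add_sub_cancel]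
  have := a.factorial_ne_zero
  push_cast
  simp
  field_simp

theorem derivVec_separated (a : ℕ) {h : Vec m → Cl m} (hh : Differentiable ℝ h) :
    derivVec (separated a h) = separated a (dirac h) := by
  funext x
  simp only [derivVec, fderiv_separated _ hh, vecPart_single_succ, separated, dirac]
  simp [Finset.smul_sum]

end Separated

/-! ### Homogeneous sums of separated functions -/

section Sums

variable {k : ℕ} {P : Vec m → Cl m}

/-- The function `∑ w b • (x₀ ^ a / a!) • (dividedPow b)(y)`, summed over `a + b = n`. -/
noncomputable def separatedSum (m k : ℕ) (P : Vec m → Cl m) (w : ℕ → ℝ) (n : ℕ)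
    (x : Vec (m + 1)) : Cl m :=
  ∑ p ∈ Finset.HasAntidiagonal.antidiagonal n, w p.2 • separated p.1 (dividedPow m k P p.2) x

theorem contDiff_separatedSum (hP : IsHomogeneousMonogenic k P) (w : ℕ → ℝ) (n : ℕ) :
    ContDiff ℝ ∞ (separatedSum m k P w n) :=
  ContDiff.sum fun _ _ => (contDiff_separated _ (contDiff_dividedPow hP _)).const_smul _

theorem differentiable_dividedPow (hP : IsHomogeneousMonogenic k P) (b : ℕ) :
    Differentiable ℝ (dividedPow m k P b) := (contDiff_dividedPow hP b).differentiable (by simp)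

theorem derivZero_separatedSum (hP : IsHomogeneousMonogenic k P) (w : ℕ → ℝ) (n : ℕ) :
    derivZero (separatedSum m k P w n) = fun x => ∑ p ∈ Finset.HasAntidiagonal.antidiagonal n,
      w p.2 • derivZero (separated p.1 (dividedPow m k P p.2)) x :=
  derivZero_sum _ _ _ fun p =>
    (contDiff_separated _ (contDiff_dividedPow hP p.2)).differentiable (by simp)

theorem derivVec_separatedSum (hP : IsHomogeneousMonogenic k P) (w : ℕ → ℝ) (n : ℕ) :
    derivVec (separatedSum m k P w n) = fun x => ∑ p ∈ Finset.HasAntidiagonal.antidiagonal n,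
      w p.2 • derivVec (separated p.1 (dividedPow m k P p.2)) x :=
  derivVec_sum _ _ _ fun p =>
    (contDiff_separated _ (contDiff_dividedPow hP p.2)).differentiable (by simp)

theorem derivZero_separatedSum_zero (hP : IsHomogeneousMonogenic k P) (w : ℕ → ℝ) :
    derivZero (separatedSum m k P w 0) = 0 := by
  rw [derivZero_separatedSum hP]
  funext x
  simp [derivZero_separated_zero (differentiable_dividedPow hP 0)]

theorem derivZero_separatedSum_succ (hP : IsHomogeneousMonogenic k P) (w : ℕ → ℝ) (n : ℕ) :
    derivZero (separatedSum m k P w (n + 1)) = separatedSum m k P w n := by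
  rw [derivZero_separatedSum hP]
  funext x
  rw [Finset.Nat.antidiagonal_succ, Finset.sum_cons, Finset.sum_map,
    derivZero_separated_zero (differentiable_dividedPow hP _)]
  simp [derivZero_separated_succ _ (differentiable_dividedPow hP _), separatedSum]

theorem derivVec_separatedSum_zero (hP : IsHomogeneousMonogenic k P) (w : ℕ → ℝ) :
    derivVec (separatedSum m k P w 0) = 0 := by
  rw [derivVec_separatedSum hP]
  funext x
  simp [derivVec_separated _ (differentiable_dividedPow hP 0), dirac_dividedPow_zero hP, separated]

theorem derivVec_separatedSum_succ (hm : 0 < m) (hP : IsHomogeneousMonogenic k P) (w : ℕ → ℝ)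
    (n : ℕ) : derivVec (separatedSum m k P w (n + 1)) =
      separatedSum m k P (fun b => -w (b + 1)) n := by
  rw [derivVec_separatedSum hP]
  funext x
  rw [Finset.Nat.antidiagonal_succ', Finset.sum_cons, Finset.sum_map]
  simp [derivVec_separated _ (differentiable_dividedPow hP _), dirac_dividedPow_zero hP, separated,
    dirac_dividedPow_succ hm hP, separatedSum]

theorem cauchyRiemann_separatedSum_const (hm : 0 < m) (hP : IsHomogeneousMonogenic k P) (a : ℝ)
    (n : ℕ) (x : Vec (m + 1)) : cauchyRiemann (separatedSum m k P (fun _ => a) n) x = 0 := by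
  rw [cauchyRiemann_eq]
  rcases n with _ | n
  · simp [derivZero_separatedSum_zero hP, derivVec_separatedSum_zero hP]
  · rw [derivZero_separatedSum_succ hP, derivVec_separatedSum_succ hm hP]
    simp [separatedSum]

theorem laplacian_separatedSum_add_two (hm : 0 < m) (hP : IsHomogeneousMonogenic k P) (w : ℕ → ℝ)
    (n : ℕ) : Laplacian.laplacian (separatedSum m k P w (n + 2)) =
      separatedSum m k P (fun b => w b - w (b + 2)) n := by
  rw [laplacian_eq_derivZero_sub_derivVec (contDiff_separatedSum hP w _),
    derivZero_separatedSum_succ hP, derivZero_separatedSum_succ hP,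
    derivVec_separatedSum_succ hm hP, derivVec_separatedSum_succ hm hP]
  funext x
  simp [separatedSum, sub_smul]

theorem laplacian_separatedSum_of_lt_two (hm : 0 < m) (hP : IsHomogeneousMonogenic k P)
    (w : ℕ → ℝ) {n : ℕ} (hn : n < 2) : Laplacian.laplacian (separatedSum m k P w n) = 0 := by
  have hc : derivZero (0 : Vec (m + 1) → Cl m) = 0 := by funext x; simp [derivZero]
  have hc' : derivVec (0 : Vec (m + 1) → Cl m) = 0 := by funext x; simp [derivVec]
  rw [laplacian_eq_derivZero_sub_derivVec (contDiff_separatedSum hP w _)]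
  interval_cases n
  · rw [derivZero_separatedSum_zero hP, derivVec_separatedSum_zero hP, hc, hc']
    simp; rfl
  · rw [derivZero_separatedSum_succ hP, derivZero_separatedSum_zero hP,
      derivVec_separatedSum_succ hm hP, derivVec_separatedSum_zero hP]
    simp; rfl

theorem vecCl_pow_mul_eq_dividedPow (hm : 0 < m) (j : ℕ) :
    (fun y => vecCl y ^ j * P y) = fun y => diracFactorial m k j • dividedPow m k P j y := by
  funext y
  rw [dividedPow, smul_smul, mul_inv_cancel₀ (diracFactorial_ne_zero hm k j), one_smul]

theorem iterate_dirac_const_smul_dividedPow (hm : 0 < m) (hP : IsHomogeneousMonogenic k P)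
    (c : ℝ) (n j : ℕ) : dirac^[n] (fun y => c • dividedPow m k P j y) =
      fun y => c • dirac^[n] (dividedPow m k P j) y := by
  induction n with
  | zero => rfl
  | succ n ih =>
    rw [Function.iterate_succ_apply', Function.iterate_succ_apply', ih, dirac_const_smul]
    rw [iterate_dirac_dividedPow hm hP]
    split_ifs
    · exact (differentiable_dividedPow hP _).const_smul ((-1 : ℝ) ^ n)
    · exact differentiable_const _

theorem ckTerm_vecCl_pow_mul (hm : 0 < m) (hP : IsHomogeneousMonogenic k P) (j : ℕ)
    (x : Vec (m + 1)) (n : ℕ) : ckTerm (fun y => vecCl y ^ j * P y) x n = if n ≤ j then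
      diracFactorial m k j • separated n (dividedPow m k P (j - n)) x else 0 := by
  rw [ckTerm, vecCl_pow_mul_eq_dividedPow (k := k) hm,
    iterate_dirac_const_smul_dividedPow hm hP, iterate_dirac_dividedPow hm hP]
  split_ifs with h
  · rw [separated, smul_smul, smul_smul, smul_smul]
    congr 1
    rw [neg_pow (x 0)]
    have : ((-1 : ℝ) ^ n) * (-1) ^ n = 1 := by rw [← mul_pow]; simp
    linear_combination (x 0 ^ n / (n.factorial : ℝ) * diracFactorial m k j) * this
  · simp

/-- The `CK` series terminates, and its sum is the homogeneous sum with constant coefficients. -/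
theorem hasSum_ckTerm (hm : 0 < m) (hP : IsHomogeneousMonogenic k P) (j : ℕ) (x : Vec (m + 1)) :
    HasSum (ckTerm (fun y => vecCl y ^ j * P y) x)
      (diracFactorial m k j • separatedSum m k P (fun _ => 1) j x) := by
  have h : diracFactorial m k j • separatedSum m k P (fun _ => 1) j x =
      ∑ n ∈ Finset.range (j + 1), ckTerm (fun y => vecCl y ^ j * P y) x n := by
    rw [separatedSum, Finset.Nat.sum_antidiagonal_eq_sum_range_succ_mk, Finset.smul_sum]
    refine Finset.sum_congr rfl fun n hn => ?_
    rw [ckTerm_vecCl_pow_mul hm hP, if_pos (by simpa [Nat.lt_succ_iff] using hn), one_smul]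
  rw [h]
  refine hasSum_sum_of_ne_finset_zero fun n hn => ?_
  rw [ckTerm_vecCl_pow_mul hm hP, if_neg (by simpa [Nat.lt_succ_iff] using hn)]

end Sums

/-! ### The polynomial coefficients and their finite differences -/

/-- The polynomial `∏_{s ≤ i < N} (2c + 1 + 2i)` in `c`. -/
noncomputable def oddProd (N s c : ℕ) : ℝ := ∏ i ∈ Finset.Ico s N, (2 * c + 1 + 2 * i : ℝ)

theorem oddProd_self (N c : ℕ) : oddProd N N c = 1 := by simp [oddProd]

theorem oddProd_ne_zero (N s c : ℕ) : oddProd N s c ≠ 0 :=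
  Finset.prod_ne_zero_iff.2 fun i _ => by positivity

theorem oddProd_eq_mul {N s : ℕ} (hs : s < N) (c : ℕ) :
    oddProd N s c = (2 * c + 1 + 2 * s) * oddProd N (s + 1) c :=
  Finset.prod_eq_prod_Ico_succ_bot hs _

theorem oddProd_succ_mul {N s : ℕ} (hs : s ≤ N) (c : ℕ) :
    oddProd N s (c + 1) * (2 * c + 1 + 2 * s) = oddProd N s c * (2 * c + 1 + 2 * N) := by
  have h1 : oddProd N s (c + 1) = ∏ i ∈ Finset.Ico (s + 1) (N + 1), (2 * c + 1 + 2 * i : ℝ) := by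
    rw [oddProd, ← Finset.prod_Ico_add' _ s N 1]
    refine Finset.prod_congr rfl fun i _ => ?_
    push_cast
    ring
  rw [h1, oddProd, ← Finset.prod_Ico_succ_top hs fun i : ℕ => (2 * c + 1 + 2 * i : ℝ),
    Finset.prod_eq_prod_Ico_succ_bot (Nat.lt_succ_of_le hs), mul_comm]

/-- Taking differences in `c` drops the factor `i = s`, hence lowers the degree by one. -/
theorem oddProd_sub_succ {N s : ℕ} (hs : s < N) (c : ℕ) :
    oddProd N s c - oddProd N s (c + 1) = 2 * ((s : ℝ) - N) * oddProd N (s + 1) c := by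
  have h := oddProd_succ_mul hs.le c
  have h0 : (2 * c + 1 + 2 * s : ℝ) ≠ 0 := by positivity
  rw [oddProd_eq_mul hs c] at h ⊢
  have h1 : oddProd N s (c + 1) = oddProd N (s + 1) c * (2 * c + 1 + 2 * N) :=
    mul_right_cancel₀ h0 (by linear_combination h)
  rw [h1]
  ring

/-- The quotient `diracFactorial m k b / b!` is a polynomial of degree `N` in `⌈b / 2⌉`, up to a
constant factor. -/
theorem diracFactorial_div_factorial {k N : ℕ} (hN : 2 * N + 1 = 2 * k + m) (b : ℕ) :
    diracFactorial m k b * oddProd N 0 0 = b.factorial * oddProd N 0 ((b + 1) / 2) := by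
  have hN' : (2 * N + 1 : ℝ) = 2 * k + m := by exact_mod_cast hN
  induction b with
  | zero => simp [diracFactorial]
  | succ b ih =>
    rw [diracFactorial, Finset.prod_range_succ, ← diracFactorial, mul_right_comm, ih,
      Nat.factorial_succ]
    rcases Nat.even_or_odd' b with ⟨c, rfl | rfl⟩
    · have h := oddProd_succ_mul (Nat.zero_le N) c
      rw [show (2 * c + 1) / 2 = c by omega, show (2 * c + 1 + 1) / 2 = c + 1 by omega,
        diracCoeff, if_neg (by simp)]
      push_cast at h ⊢
      linear_combination -((2 * c).factorial : ℝ) * h -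
        ((2 * c).factorial : ℝ) * oddProd N 0 c * hN'
    · rw [show (2 * c + 1 + 1) / 2 = c + 1 by omega,
        show (2 * c + 1 + 1 + 1) / 2 = c + 1 by omega, diracCoeff,
        if_pos ⟨c + 1, by ring⟩]
      push_cast
      ring

section Iterate

variable {k : ℕ} {P : Vec m → Cl m}

/-- Iterating the Laplacian lowers the degree in `⌈b / 2⌉` of the polynomial coefficients by one at
each step, since `∂₀² - D²` acts on them as a finite difference. -/
theorem iterate_laplacian_separatedSum (hm : 0 < m) (hP : IsHomogeneousMonogenic k P) (N : ℕ)
    (A : ℝ) (n s : ℕ) (hs : s ≤ N) :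
    (Laplacian.laplacian (E := Vec (m + 1) → Cl m))^[s]
      (separatedSum m k P (fun b => A * oddProd N 0 ((b + 1) / 2)) n) =
      if 2 * s ≤ n then separatedSum m k P
        (fun b => A * (∏ i ∈ Finset.range s, 2 * ((i : ℝ) - N)) * oddProd N s ((b + 1) / 2))
        (n - 2 * s) else 0 := by
  induction s with
  | zero => simp
  | succ s ih =>
    rw [Function.iterate_succ_apply', ih (by omega)]
    by_cases h : 2 * s ≤ n
    · rw [if_pos h]
      by_cases h' : 2 * (s + 1) ≤ n
      · rw [if_pos h', show n - 2 * s = n - 2 * (s + 1) + 2 by omega,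
          laplacian_separatedSum_add_two hm hP]
        congr 1
        funext b
        rw [show (b + 2 + 1) / 2 = (b + 1) / 2 + 1 by omega, ← mul_sub,
          oddProd_sub_succ (by omega), Finset.prod_range_succ]
        ring
      · rw [if_neg h', laplacian_separatedSum_of_lt_two hm hP _ (by omega)]
    · rw [if_neg h, if_neg (by omega)]
      exact InnerProductSpace.laplacian_const (E := Vec (m + 1)) (F := Cl m) (c := 0)

end Iterate

/-! ### The axial function as a power series -/

/-- The paravector `x₀ + vec x` in the Clifford algebra. -/
noncomputable def paravector (x : Vec (m + 1)) : Cl m :=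
  algebraMap ℝ (Cl m) (x 0) + vecCl (vecPart x)

theorem contDiff_paravector : ContDiff ℝ ∞ (paravector (m := m)) := by
  have h1 : ContDiff ℝ ∞ fun x : Vec (m + 1) => vecCl (vecPart x) :=
    (vecClL m).contDiff.comp (vecPartL m).contDiff
  unfold paravector
  simp only [Algebra.algebraMap_eq_smul_one]
  exact ContDiff.add (by fun_prop) h1

theorem paravector_pow_mul {k : ℕ} {P : Vec m → Cl m} (hm : 0 < m) (n : ℕ)
    (x : Vec (m + 1)) : paravector x ^ n * P (vecPart x) = separatedSum m k P
      (fun b => n.factorial * (diracFactorial m k b / b.factorial)) n x := by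
  have hc : Commute (algebraMap ℝ (Cl m) (x 0)) (vecCl (vecPart x)) :=
    Algebra.commutes _ _
  rw [paravector, hc.add_pow', separatedSum, Finset.sum_mul]
  refine Finset.sum_congr rfl fun p hp => ?_
  have hpn : p.1 + p.2 = n := by simpa using hp
  have h1 : ((n.choose p.1 : ℕ) : ℝ) = n.factorial / (p.1.factorial * p.2.factorial) := by
    rw [← hpn, Nat.choose_symm_add, Nat.add_choose,
      Nat.cast_div (Nat.factorial_mul_factorial_dvd_factorial_add _ _) (by positivity)]
    push_cast
    rfl
  rw [separated, dividedPow, ← map_pow, ← Algebra.smul_def, ← Nat.cast_smul_eq_nsmul ℝ, h1,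
    smul_smul, smul_smul, smul_smul, smul_mul_assoc]
  congr 1
  have := diracFactorial_ne_zero hm k p.2
  field_simp

/-- The map `u + i v ↦ u + ω v`, where `ω` is the direction of `y` (and `0` for `y = 0`). -/
noncomputable def complexToCl (y : Vec m) : ℂ →L[ℝ] Cl m :=
  Complex.reCLM.smulRight 1 + Complex.imCLM.smulRight (vecCl (‖y‖⁻¹ • y))

theorem complexToCl_apply (y : Vec m) (z : ℂ) :
    complexToCl y z = algebraMap ℝ (Cl m) z.re + z.im • vecCl (‖y‖⁻¹ • y) := by
  simp [complexToCl, Algebra.algebraMap_eq_smul_one]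

theorem complexToCl_pow (x : Vec (m + 1)) (n : ℕ) :
    complexToCl (vecPart x) ((⟨x 0, ‖vecPart x‖⟩ : ℂ) ^ n) = paravector x ^ n := by
  induction n with
  | zero => simp [complexToCl_apply]
  | succ n ih =>
    rw [pow_succ, pow_succ, ← ih]
    set y := vecPart x with hy
    set w : Cl m := vecCl (‖y‖⁻¹ • y) with hw
    have h1 : vecCl y = ‖y‖ • w := by
      rw [hw, ← map_smul, smul_smul]
      rcases eq_or_ne y 0 with h | h
      · simp [h]
      · rw [mul_inv_cancel₀ (norm_ne_zero_iff.2 h), one_smul]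
    -- Only `|y| w² = -|y|` is needed, so that `y = 0` is no exception.
    have h2 : ‖y‖ • (w * w) = -‖y‖ • (1 : Cl m) := by
      rw [hw, vecCl_mul_self, Algebra.algebraMap_eq_smul_one, smul_smul]
      rcases eq_or_ne y 0 with h | h
      · simp [h]
      · rw [norm_smul, norm_inv, norm_norm, inv_mul_cancel₀ (norm_ne_zero_iff.2 h)]
        simp
    simp only [complexToCl_apply, paravector, ← hy, ← hw, h1, Complex.mul_re, Complex.mul_im,
      Algebra.algebraMap_eq_smul_one, add_mul, mul_add, smul_mul_smul_comm, one_mul, mul_one]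
    have h3 : ∀ a : ℝ, (a * ‖y‖) • (w * w) = -(a * ‖y‖) • (1 : Cl m) := fun a => by
      rw [mul_smul, h2, smul_smul, mul_neg]
    rw [h3]
    module

theorem hasSum_axial {c : ℕ → ℝ} {H : ℂ → ℂ}
    (hH : ∀ z : ℂ, HasSum (fun n => (c n : ℂ) * z ^ n) (H z)) (P : Vec m → Cl m)
    (x : Vec (m + 1)) :
    HasSum (fun n => c n • (paravector x ^ n * P (vecPart x))) (axial H P x) := by
  have h := (((mulL m).flip (P (vecPart x))).comp (complexToCl (vecPart x))).hasSum
    (hH ⟨x 0, ‖vecPart x‖⟩)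
  have h1 : ∀ n, ((mulL m).flip (P (vecPart x))).comp (complexToCl (vecPart x))
      ((c n : ℂ) * ⟨x 0, ‖vecPart x‖⟩ ^ n) = c n • (paravector x ^ n * P (vecPart x)) := by
    intro n
    rw [← complexToCl_pow, ← Complex.real_smul, map_smul]
    rfl
  simp only [h1] at h
  have h2 : axial H P x =
      complexToCl (vecPart x) (H ⟨x 0, ‖vecPart x‖⟩) * P (vecPart x) := by
    rw [complexToCl_apply, axial]
  rw [h2]
  exact h

theorem smoothSummable_paravector {c : ℕ → ℝ} {H : ℂ → ℂ}
    (hH : ∀ z : ℂ, HasSum (fun n => (c n : ℂ) * z ^ n) (H z)) {P : Vec m → Cl m}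
    (hP : IsPolynomial P) :
    SmoothSummable fun n (x : Vec (m + 1)) => c n • (paravector x ^ n * P (vecPart x)) := by
  refine smoothSummable_smul_of_bilin (mulL m) contDiff_paravector _ ?_ ?_ c ?_
  · simp only [pow_zero, one_mul]
    exact hP.contDiff.comp (vecPartL m).contDiff
  · intro n x
    rw [mulL_apply, pow_succ', mul_assoc]
  · intro M hM
    simpa [abs_of_nonneg hM] using (hH M).summable.norm

/-- The factor by which `Δ ^ N` of `paravector x ^ n * P` differs from the homogeneous sum of degree
`n - 2N` with all coefficients `1`. -/
noncomputable def fueterConst (N n : ℕ) : ℝ :=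
  n.factorial / oddProd N 0 0 * ∏ i ∈ Finset.range N, 2 * ((i : ℝ) - N)

theorem iterate_laplacian_paravector_pow {k N : ℕ} {P : Vec m → Cl m} (hm : 0 < m)
    (hP : IsHomogeneousMonogenic k P) (hN : 2 * N + 1 = 2 * k + m) (a : ℝ) (n : ℕ) :
    (Laplacian.laplacian (E := Vec (m + 1) → Cl m))^[N]
      (fun x => a • (paravector x ^ n * P (vecPart x))) =
      if 2 * N ≤ n then separatedSum m k P (fun _ => a * fueterConst N n) (n - 2 * N) else 0 := by
  have h : (fun x : Vec (m + 1) => a • (paravector x ^ n * P (vecPart x))) =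
      separatedSum m k P
        (fun b => a * (n.factorial / oddProd N 0 0) * oddProd N 0 ((b + 1) / 2)) n := by
    funext x
    rw [paravector_pow_mul (k := k) hm, separatedSum, separatedSum, Finset.smul_sum]
    refine Finset.sum_congr rfl fun p _ => ?_
    rw [smul_smul]
    congr 1
    have h1 := diracFactorial_div_factorial hN p.2
    have h2 := oddProd_ne_zero N 0 0
    field_simp
    linear_combination a * h1
  rw [h, iterate_laplacian_separatedSum hm hP N _ n N le_rfl]
  simp only [oddProd_self, fueterConst, mul_one, mul_assoc]

end Fueter

theorem proposition1 (m : ℕ) (hm : Odd m) (k : ℕ) (P : Vec m → Cl m)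
    (hP : IsHomogeneousMonogenic k P) (c : ℕ → ℝ) (H : ℂ → ℂ)
    (hH : ∀ z : ℂ, HasSum (fun n => (c n : ℂ) * z ^ n) (H z)) :
    MonogenicOn (Ft k H P) Set.univ ∧
    (∀ (j : ℕ) (x : Vec (m + 1)), Summable (ckTerm (fun y => vecCl y ^ j * P y) x)) ∧
    ∃ C : ℕ → ℝ, ∀ x : Vec (m + 1),
      HasSum (fun n : {n : ℕ // 2 * k + m - 1 ≤ n} =>
        C n • CK (fun y => vecCl y ^ ((n : ℕ) - (2 * k + m - 1)) * P y) x) (Ft k H P x) := by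
  have hm0 : 0 < m := hm.pos
  obtain ⟨N, hNdef⟩ : ∃ N, N = k + (m - 1) / 2 := ⟨_, rfl⟩
  have hN : 2 * N + 1 = 2 * k + m := by
    obtain ⟨t, rfl⟩ := hm
    omega
  have hN' : 2 * k + m - 1 = 2 * N := by omega
  have hS := smoothSummable_paravector hH hP.isPolynomial
  have hFt : Ft k H P = fun x => ∑' n, (Laplacian.laplacian (E := Vec (m + 1) → Cl m))^[N]
      (fun x => c n • (paravector x ^ n * P (vecPart x))) x := by
    rw [← hS.iterate_laplacian_tsum, Ft, ← hNdef]
    congr 1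
    funext x
    exact (hasSum_axial hH P x).tsum_eq.symm
  replace hS := hS.iterate_laplacian N
  simp only [iterate_laplacian_paravector_pow hm0 hP hN] at hS hFt
  refine ⟨⟨?_, fun x _ => ?_⟩, fun j x => (hasSum_ckTerm hm0 hP j x).summable, ?_⟩
  · rw [hFt]
    exact hS.contDiff_one_tsum.contDiffOn
  · rw [cauchyRiemann_eq_symbol, hFt, hS.fderiv_tsum,
      ContinuousLinearMap.map_tsum _ (hS.fderiv.summable x)]
    have h0 : ∀ n, cauchyRiemannSymbol m (fderiv ℝ (if 2 * N ≤ n then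
        separatedSum m k P (fun _ => c n * fueterConst N n) (n - 2 * N) else 0) x) = 0 := by
      intro n
      split_ifs
      · rw [← cauchyRiemann_eq_symbol, cauchyRiemann_separatedSum_const hm0 hP]
      · simp
    simp only [h0, tsum_zero]
  · refine ⟨fun n => c n * fueterConst N n / diracFactorial m k (n - 2 * N), fun x => ?_⟩
    rw [hN']
    have hsum := (hS.summable x).hasSum
    rw [← congrFun hFt x] at hsum
    have hsupp : Function.support (fun n => (if 2 * N ≤ n then separatedSum m k P
        (fun _ => c n * fueterConst N n) (n - 2 * N) else 0) x) ⊆ {n | 2 * N ≤ n} := by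
      intro n hn
      by_contra h
      exact hn (by simp [show ¬ 2 * N ≤ n from h])
    refine Eq.mp (congrArg (fun g => HasSum g _) (funext fun n => ?_))
      ((hasSum_subtype_iff_of_support_subset hsupp).2 hsum)
    obtain ⟨n, hn⟩ := n
    have hf := diracFactorial_ne_zero hm0 k (n - 2 * N)
    rw [CK, (hasSum_ckTerm hm0 hP _ x).tsum_eq, smul_smul, div_mul_cancel₀ _ hf]
    simp [show 2 * N ≤ n from hn, separatedSum, Finset.smul_sum]
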